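/- Let $p>1$, let $N\ge 2$ be an integer, and let $f\colon\mathbb{R}\to\mathbb{R}$ be a continuous function such that $f(t)>0$ for all $t<0$, $f$ is nonincreasing on $(-\infty,0)$, and $$\int_{-\infty}^{-1}\left(\int_t^{-1} f(s)\,ds\right)^{-1/p}dt<+\infty .$$ Let $u$ be a solution of $$-\operatorname{div}\left(|\nabla u|^{p-2}\nabla u\right)\ge f(u)\quad\text{on }\mathbb{R}^N,$$ meaning that $u\in C^1(\mathbb{R}^N)$ and that $$\int_{\mathbb{R}^N}|\nabla u|^{p-2}\,\nabla u\cdot\nabla\phi\,dx\ \ge\ \int_{\mathbb{R}^N}f(u)\,\phi\,dx$$ for every nonnegative $\phi\in C^1(\mathbb{R}^N)$ with compact support (where $|\xi|^{p-2}\xi:=0$ for $\xi=0$). Then $u\ge 0$ on $\mathbb{R}^N$. If moreover $f(t)\ge 0$ for all $t\ge 0$, then either $u(x)=0$ for all $x\in\mathbb{R}^N$, or $u(x)>0$ for all $x\in\mathbb{R}^N$. -/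

import Mathlib

open MeasureTheory

/-- The vector field `|ξ|^(p-2) ξ` of the `p`-Laplacian. At `ξ = 0` its value is `0`, which for
every `p > 1` is its continuous extension. -/
noncomputable def pFlux {N : ℕ} (p : ℝ) (ξ : EuclideanSpace ℝ (Fin N)) :
    EuclideanSpace ℝ (Fin N) :=
  ‖ξ‖ ^ (p - 2) • ξ

/-- `u` is a (weak `C¹`) solution of `-div(|∇u|^(p-2) ∇u) ≥ f(u)` on `ℝ^N`: `u` is of class `C¹`
and `∫ |∇u|^(p-2) ∇u · ∇φ ≥ ∫ f(u) φ` for every nonnegative `C¹` function `φ` with compact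
support. For `p > 1` and `f` continuous, both integrands are continuous with compact support. -/
def IsSolutionPLaplaceGe {N : ℕ} (p : ℝ) (f : ℝ → ℝ) (u : EuclideanSpace ℝ (Fin N) → ℝ) : Prop :=
  ContDiff ℝ 1 u ∧
    ∀ φ : EuclideanSpace ℝ (Fin N) → ℝ, ContDiff ℝ 1 φ → HasCompactSupport φ → (∀ x, 0 ≤ φ x) →
      ∫ x, f (u x) * φ x ≤ ∫ x, inner ℝ (pFlux p (gradient u x)) (gradient φ x)

/-! Both claims come from comparing `u` with explicit radial barriers `z` whose flux has the form `a
x • (x - x₀)`. The comparison principle (`IsSolutionPLaplaceGe.le_of_subsolution`) rests on strict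
monotonicity of the flux; it needs the differential inequality for `z` only where `u < z`.

Nonnegativity: the integral condition on `f` is of Keller–Osserman type, so the ODE `(w' ^ (p - 1))'
= (1 - 1 / p) f(-w)` has a solution from any small `α > 0` that blows up at a finite `T`. With `q =
p / (p - 1)`, the function `-w (l ‖x - x₀‖ ^ q)` has value `-α` at `x₀` and tends to `-∞` at the
boundary of a ball, hence lies below `u` there. For small `l` it is a subsolution; the ball may then
be large, which is harmless on the whole space. So `-α ≤ u x₀`, impossible when `u x₀ < -α`.

Dichotomy: at a zero of `u` nearest to a point where `u > 0`, a Hopf barrier with nonzero gradient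
touches `u` from below, while `∇u = 0` at this minimum. -/

/-! ### Continuity and strict monotonicity of the flux -/

theorem norm_pFlux {N : ℕ} {p : ℝ} (hp : 1 < p) (ξ : EuclideanSpace ℝ (Fin N)) :
    ‖pFlux p ξ‖ = ‖ξ‖ ^ (p - 1) := by
  rcases eq_or_ne ξ 0 with rfl | h
  · simp [pFlux, Real.zero_rpow (sub_pos.2 hp).ne']
  · have h' := norm_pos_iff.2 h
    rw [pFlux, norm_smul, Real.norm_of_nonneg (by positivity), ← Real.rpow_add_one h'.ne']
    congr 1; ring

theorem continuous_pFlux {N : ℕ} {p : ℝ} (hp : 1 < p) :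
    Continuous (pFlux p : EuclideanSpace ℝ (Fin N) → EuclideanSpace ℝ (Fin N)) := by
  rw [continuous_iff_continuousAt]
  intro ξ
  rcases eq_or_ne ξ 0 with rfl | h
  · have h0 : pFlux p (0 : EuclideanSpace ℝ (Fin N)) = 0 := by simp [pFlux]
    rw [ContinuousAt, h0, tendsto_zero_iff_norm_tendsto_zero]
    simp only [norm_pFlux hp]
    have : Continuous fun ξ : EuclideanSpace ℝ (Fin N) => ‖ξ‖ ^ (p - 1) :=
      continuous_norm.rpow_const fun _ => Or.inr (sub_pos.2 hp).le
    simpa [Real.zero_rpow (sub_pos.2 hp).ne'] using this.tendsto 0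
  · exact (continuousAt_id.norm.rpow_const (Or.inl (norm_ne_zero_iff.2 h))).smul continuousAt_id

theorem rpow_sub_two_mul_self {p a : ℝ} (hp : 1 < p) (ha : 0 ≤ a) :
    a ^ (p - 2) * a = a ^ (p - 1) := by
  rcases ha.eq_or_lt with rfl | h
  · simp [Real.zero_rpow (sub_pos.2 hp).ne']
  · rw [← Real.rpow_add_one h.ne']; congr 1; ring

/-- If the norms differ, Cauchy–Schwarz reduces this to strict monotonicity of `t ↦ t ^ (p - 1)`. If
they agree, the product equals `‖η‖ ^ (p - 2) * ‖ξ - η‖ ^ 2`. -/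
theorem inner_pFlux_sub_pos {N : ℕ} {p : ℝ} (hp : 1 < p) {ξ η : EuclideanSpace ℝ (Fin N)}
    (h : ξ ≠ η) : 0 < inner ℝ (pFlux p ξ - pFlux p η) (ξ - η) := by
  have hexp : inner ℝ (pFlux p ξ - pFlux p η) (ξ - η) =
      ‖ξ‖ ^ (p - 2) * ‖ξ‖ ^ 2 + ‖η‖ ^ (p - 2) * ‖η‖ ^ 2
        - (‖ξ‖ ^ (p - 2) + ‖η‖ ^ (p - 2)) * inner ℝ ξ η := by
    simp only [pFlux, inner_sub_left, inner_sub_right, real_inner_smul_left,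
      real_inner_self_eq_norm_sq, real_inner_comm ξ η]
    ring
  rcases eq_or_ne ‖ξ‖ ‖η‖ with hn | hn
  · have hpos : 0 < ‖η‖ := by
      rcases eq_or_ne η 0 with rfl | h0
      · exact absurd (by simpa using hn) h
      · exact norm_pos_iff.2 h0
    have h2 : 0 < ‖ξ - η‖ ^ 2 := by
      have := norm_pos_iff.2 (sub_ne_zero.2 h); positivity
    rw [norm_sub_sq_real, hn] at h2
    rw [hexp, hn]
    have := mul_pos (Real.rpow_pos_of_pos hpos (p - 2)) h2
    linarith
  · have hcs := mul_le_mul_of_nonneg_left (real_inner_le_norm ξ η)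
      (by positivity : 0 ≤ ‖ξ‖ ^ (p - 2) + ‖η‖ ^ (p - 2))
    have e1 := rpow_sub_two_mul_self hp (norm_nonneg ξ)
    have e2 := rpow_sub_two_mul_self hp (norm_nonneg η)
    have key : 0 < (‖ξ‖ ^ (p - 1) - ‖η‖ ^ (p - 1)) * (‖ξ‖ - ‖η‖) := by
      rcases hn.lt_or_gt with hlt | hlt
      · exact mul_pos_of_neg_of_neg (sub_neg.2
          (Real.rpow_lt_rpow (norm_nonneg _) hlt (sub_pos.2 hp))) (sub_neg.2 hlt)
      · exact mul_pos (sub_pos.2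
          (Real.rpow_lt_rpow (norm_nonneg _) hlt (sub_pos.2 hp))) (sub_pos.2 hlt)
    rw [← e1, ← e2] at key
    rw [hexp]
    nlinarith

/-! ### The comparison principle -/

/-- Squaring the positive part makes the truncation `C¹`, as required of test functions. -/
theorem hasDerivAt_posPart_sq (t : ℝ) :
    HasDerivAt (fun t : ℝ => (max t 0) ^ 2) (2 * max t 0) t := by
  rcases lt_trichotomy t 0 with h | rfl | h
  · rw [max_eq_right h.le, mul_zero]
    refine (hasDerivAt_const t (0 : ℝ)).congr_of_eventuallyEq ?_
    filter_upwards [eventually_lt_nhds h] with s hs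
    simp [max_eq_right hs.le]
  · rw [hasDerivAt_iff_isLittleO]
    have h1 : (fun s : ℝ => (max s 0) ^ 2) =O[nhds 0] fun s => s ^ 2 := by
      refine Asymptotics.IsBigO.of_bound 1 (Filter.Eventually.of_forall fun s => ?_)
      rw [one_mul, Real.norm_of_nonneg (by positivity), Real.norm_of_nonneg (by positivity)]
      rcases le_total s 0 with hs | hs
      · simp [max_eq_right hs]; positivity
      · simp [max_eq_left hs]
    have h2 := h1.trans_isLittleO (Asymptotics.isLittleO_pow_id (𝕜 := ℝ) one_lt_two)
    simpa using h2
  · rw [max_eq_left h.le]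
    refine ((hasDerivAt_pow 2 t).congr_of_eventuallyEq ?_).congr_deriv (by simp)
    filter_upwards [eventually_gt_nhds h] with s hs
    simp [max_eq_left hs.le]

theorem contDiff_posPart_sq : ContDiff ℝ 1 (fun t : ℝ => (max t 0) ^ 2) := by
  rw [contDiff_one_iff_deriv]
  refine ⟨fun t => (hasDerivAt_posPart_sq t).differentiableAt, ?_⟩
  rw [show deriv (fun t : ℝ => (max t 0) ^ 2) = fun t => 2 * max t 0 from
    funext fun t => (hasDerivAt_posPart_sq t).deriv]
  fun_prop

/-- The divergence theorem for the compactly supported field `η (x - x₀)`. -/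
theorem integral_divergence_radial_eq_zero {N : ℕ} {η : EuclideanSpace ℝ (Fin N) → ℝ}
    (hη : ContDiff ℝ 1 η) (hc : HasCompactSupport η) (x₀ : EuclideanSpace ℝ (Fin N)) :
    ∫ x, (N * η x + fderiv ℝ η x (x - x₀)) = 0 := by
  have hd : Continuous fun x => fderiv ℝ η x := hη.continuous_fderiv one_ne_zero
  have hdc : HasCompactSupport (fderiv ℝ η) := hc.fderiv ℝ
  let e : Fin N → EuclideanSpace ℝ (Fin N) := fun i => EuclideanSpace.single i 1
  have hcoord : ∀ i, Continuous fun x : EuclideanSpace ℝ (Fin N) => x i - x₀ i := fun i => by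
    fun_prop
  have hdi : ∀ i, Integrable fun x => (x i - x₀ i) * fderiv ℝ η x (e i) := fun i => by
    refine Continuous.integrable_of_hasCompactSupport
      ((hcoord i).mul (hd.clm_apply continuous_const)) ?_
    refine HasCompactSupport.mul_left ?_
    exact hdc.comp_left (g := fun L : EuclideanSpace ℝ (Fin N) →L[ℝ] ℝ => L (e i)) (by simp)
  have hηi : Integrable η := hη.continuous.integrable_of_hasCompactSupport hc
  -- Integration by parts in each coordinate; the factor `x i - x₀ i` is not integrable itself, but
  -- every product that occurs has compact support.
  have hparts : ∀ i, ∫ x, (x i - x₀ i) * fderiv ℝ η x (e i) = - ∫ x, η x := fun i => by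
    have hf : ∀ x, HasFDerivAt (fun x : EuclideanSpace ℝ (Fin N) => x i - x₀ i)
        (EuclideanSpace.proj i : EuclideanSpace ℝ (Fin N) →L[ℝ] ℝ) x := fun x =>
      ((EuclideanSpace.proj i : EuclideanSpace ℝ (Fin N) →L[ℝ] ℝ).hasFDerivAt).sub_const _
    have hf1 : ∀ x, fderiv ℝ (fun x : EuclideanSpace ℝ (Fin N) => x i - x₀ i) x (e i) = 1 :=
      fun x => by rw [(hf x).fderiv]; simp [e]
    have := integral_mul_fderiv_eq_neg_fderiv_mul_of_integrable (μ := volume)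
      (f := fun x : EuclideanSpace ℝ (Fin N) => x i - x₀ i) (g := η) (v := e i)
      (by simpa only [hf1, one_mul] using hηi) (hdi i)
      (((hcoord i).mul hη.continuous).integrable_of_hasCompactSupport hc.mul_left)
      (fun x _ => (hf x).differentiableAt) (fun x _ => hη.differentiable one_ne_zero x)
    simpa only [hf1, one_mul] using this
  have hsum : ∀ x, fderiv ℝ η x (x - x₀) = ∑ i, (x i - x₀ i) * fderiv ℝ η x (e i) := fun x => by
    have : x - x₀ = ∑ i, (x i - x₀ i) • e i := by
      ext j
      simp [e, Finset.sum_apply, Pi.single_apply]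
    conv_lhs => rw [this, map_sum]
    simp
  simp only [hsum]
  rw [integral_add (hηi.const_mul _) (integrable_finsetSum _ fun i _ => hdi i),
    integral_finsetSum _ fun i _ => hdi i, integral_const_mul]
  simp [hparts]

/-- Comparison of a solution `u` with an explicit subsolution `z` whose flux is a multiple of the
radial field `x - x₀`. -/
theorem IsSolutionPLaplaceGe.le_of_subsolution {N : ℕ} [NeZero N] {p : ℝ} (hp : 1 < p)
    {f : ℝ → ℝ} (hf : Continuous f) {u : EuclideanSpace ℝ (Fin N) → ℝ}
    (hu : IsSolutionPLaplaceGe p f u) {U K : Set (EuclideanSpace ℝ (Fin N))} (hU : IsOpen U)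
    (hK : IsCompact K) (hKU : K ⊆ U) {z a : EuclideanSpace ℝ (Fin N) → ℝ}
    {x₀ : EuclideanSpace ℝ (Fin N)} (hz : ∀ x ∈ U, ContDiffAt ℝ 1 z x)
    (ha : ∀ x ∈ U, ContDiffAt ℝ 1 a x)
    (hflux : ∀ x ∈ U, pFlux p (gradient z x) = a x • (x - x₀))
    (hdiv : ∀ x ∈ U, u x < z x → -(N * a x + fderiv ℝ a x (x - x₀)) ≤ f (u x))
    (hle : ∀ x ∈ U, x ∉ K → z x ≤ u x) : ∀ x ∈ U, z x ≤ u x := by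
  classical
  obtain ⟨huC, hut⟩ := hu
  -- Nothing is known about `z` off `U`; extension by zero is still `C¹` because `z ≤ u` on `U \ K`.
  set ζ : EuclideanSpace ℝ (Fin N) → ℝ := fun x => if x ∈ U then (max (z x - u x) 0) ^ 2 else 0
    with hζ
  have hζU : ∀ x ∈ U, ζ =ᶠ[nhds x] fun x => (max (z x - u x) 0) ^ 2 := fun x hx => by
    filter_upwards [hU.mem_nhds hx] with y hy
    simp [hζ, hy]
  have hζK : ∀ x, x ∉ K → ζ x = 0 := fun x hx => by
    by_cases hxU : x ∈ U
    · simp [hζ, hxU, max_eq_right (sub_nonpos.2 (hle x hxU hx))]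
    · simp [hζ, hxU]
  have hζKn : ∀ x, x ∉ K → ζ =ᶠ[nhds x] fun _ => 0 := fun x hx => by
    filter_upwards [hK.isClosed.isOpen_compl.mem_nhds hx] with y hy
    exact hζK y hy
  have hζc : HasCompactSupport ζ := HasCompactSupport.intro hK hζK
  have hζ1 : ContDiff ℝ 1 ζ := by
    rw [contDiff_iff_contDiffAt]
    intro x
    by_cases hx : x ∈ K
    · exact (contDiff_posPart_sq.contDiffAt.comp x
        ((hz x (hKU hx)).sub huC.contDiffAt)).congr_of_eventuallyEq (hζU x (hKU hx))
    · exact contDiffAt_const.congr_of_eventuallyEq (hζKn x hx)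
  have hζ0 : ∀ x, 0 ≤ ζ x := fun x => by
    simp only [hζ]; split_ifs <;> positivity
  -- the gradient of the test function
  have hgradK : ∀ x, x ∉ K → gradient ζ x = 0 := fun x hx => by
    rw [gradient, (hζKn x hx).fderiv_eq]; simp
  have hgradU : ∀ x ∈ U, gradient ζ x =
      (2 * max (z x - u x) 0) • (gradient z x - gradient u x) := fun x hx => by
    have h1 : HasFDerivAt (fun x => z x - u x) (fderiv ℝ z x - fderiv ℝ u x) x :=
      ((hz x hx).differentiableAt one_ne_zero).hasFDerivAt.sub
        (huC.differentiable one_ne_zero x).hasFDerivAt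
    have h2 := (hasDerivAt_posPart_sq (z x - u x)).comp_hasFDerivAt x h1
    have h3 : fderiv ℝ ζ x = (2 * max (z x - u x) 0) • (fderiv ℝ z x - fderiv ℝ u x) := by
      rw [(hζU x hx).fderiv_eq]; exact h2.fderiv
    simp only [gradient, h3, map_smul, map_sub]
  have hgrad : ∀ x y, inner ℝ y (gradient ζ x) = fderiv ℝ ζ x y := fun x y => by
    rw [real_inner_comm, gradient, InnerProductSpace.toDual_symm_apply]
  have hgc : Continuous (gradient ζ) :=
    (InnerProductSpace.toDual ℝ _).symm.continuous.comp (hζ1.continuous_fderiv one_ne_zero)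
  have hguc : Continuous (gradient u) :=
    (InnerProductSpace.toDual ℝ _).symm.continuous.comp (huC.continuous_fderiv one_ne_zero)
  -- the field tested against `ζ`
  set η : EuclideanSpace ℝ (Fin N) → ℝ := fun x => ζ x * a x with hη
  have hη1 : ContDiff ℝ 1 η := by
    rw [contDiff_iff_contDiffAt]
    intro x
    by_cases hx : x ∈ K
    · exact hζ1.contDiffAt.mul (ha x (hKU hx))
    · refine (contDiffAt_const (c := (0 : ℝ))).congr_of_eventuallyEq ?_
      filter_upwards [hζKn x hx] with y hy
      simp [hη, hy]
  have hηc : HasCompactSupport η := hζc.mul_right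
  have hηint := integral_divergence_radial_eq_zero hη1 hηc x₀
  set D : EuclideanSpace ℝ (Fin N) → ℝ := fun x => N * η x + fderiv ℝ η x (x - x₀) with hD
  have hDc : Continuous D := by
    have := hη1.continuous_fderiv one_ne_zero
    have := hη1.continuous
    fun_prop
  have hDK : ∀ x, x ∉ K → D x = 0 := fun x hx => by
    have : η =ᶠ[nhds x] fun _ => 0 := by
      filter_upwards [hζKn x hx] with y hy
      simp [hη, hy]
    simp only [hD, this.fderiv_eq, this.eq_of_nhds]
    simp
  have hDs : HasCompactSupport D := HasCompactSupport.intro hK hDK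
  have hDU : ∀ x ∈ U, D x = ζ x * (N * a x + fderiv ℝ a x (x - x₀))
      + inner ℝ (pFlux p (gradient z x)) (gradient ζ x) := fun x hx => by
    have h1 : HasFDerivAt η (ζ x • fderiv ℝ a x + a x • fderiv ℝ ζ x) x :=
      (hζ1.differentiable one_ne_zero x).hasFDerivAt.mul
        ((ha x hx).differentiableAt one_ne_zero).hasFDerivAt
    simp only [hD, h1.fderiv, hflux x hx, hgrad]
    simp [hη]
    ring
  -- `P` has integral at most `0` by the weak inequality and the divergence theorem. On `U` it
  -- dominates the monotonicity product weighted by `2 (z - u)⁺`, so `P ≥ 0`. By continuity `P`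
  -- vanishes, which forces `∇ζ = 0`.
  set P : EuclideanSpace ℝ (Fin N) → ℝ := fun x => f (u x) * ζ x + D x
    - inner ℝ (pFlux p (gradient u x)) (gradient ζ x) with hP
  have hfc : Continuous fun x => f (u x) * ζ x :=
    (hf.comp huC.continuous).mul hζ1.continuous
  have hfs : HasCompactSupport fun x => f (u x) * ζ x := hζc.mul_left
  have hic : Continuous fun x => inner ℝ (pFlux p (gradient u x)) (gradient ζ x) :=
    ((continuous_pFlux hp).comp hguc).inner hgc
  have hiK : ∀ x, x ∉ K → inner ℝ (pFlux p (gradient u x)) (gradient ζ x) = 0 := fun x hx => by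
    rw [hgradK x hx, inner_zero_right]
  have his : HasCompactSupport fun x => inner ℝ (pFlux p (gradient u x)) (gradient ζ x) :=
    HasCompactSupport.intro hK hiK
  have hPc : Continuous P := (hfc.add hDc).sub hic
  have hPK : ∀ x, x ∉ K → P x = 0 := fun x hx => by
    simp only [hP, hDK x hx, hζK x hx, hiK x hx]; simp
  have hPs : HasCompactSupport P := HasCompactSupport.intro hK hPK
  have hQP : ∀ x ∈ U, 2 * max (z x - u x) 0 *
      inner ℝ (pFlux p (gradient z x) - pFlux p (gradient u x)) (gradient z x - gradient u x)
        ≤ P x := fun x hx => by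
    have e1 : 2 * max (z x - u x) 0 *
        inner ℝ (pFlux p (gradient z x) - pFlux p (gradient u x)) (gradient z x - gradient u x) =
        inner ℝ (pFlux p (gradient z x)) (gradient ζ x)
          - inner ℝ (pFlux p (gradient u x)) (gradient ζ x) := by
      rw [← inner_sub_left, hgradU x hx, real_inner_smul_right]
    have e2 : 0 ≤ ζ x * (f (u x) + (N * a x + fderiv ℝ a x (x - x₀))) := by
      rcases lt_or_ge (u x) (z x) with h | h
      · exact mul_nonneg (hζ0 x) (by linarith [hdiv x hx h])
      · simp [hζ, hx, max_eq_right (sub_nonpos.2 h)]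
    rw [e1]
    simp only [hP, hDU x hx]
    linarith
  have hmono : ∀ x, 0 ≤ inner ℝ (pFlux p (gradient z x) - pFlux p (gradient u x))
      (gradient z x - gradient u x) := fun x => by
    rcases eq_or_ne (gradient z x) (gradient u x) with h | h
    · simp [h]
    · exact (inner_pFlux_sub_pos hp h).le
  have hP0 : 0 ≤ P := fun x => by
    by_cases hx : x ∈ U
    · exact (mul_nonneg (by positivity) (hmono x)).trans (hQP x hx)
    · exact (hPK x fun h => hx (hKU h)).ge
  have hPint : ∫ x, P x ≤ 0 := by
    have hi1 := hfc.integrable_of_hasCompactSupport (μ := volume) hfs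
    have hi2 := hDc.integrable_of_hasCompactSupport (μ := volume) hDs
    have hi3 := hic.integrable_of_hasCompactSupport (μ := volume) his
    have := hut ζ hζ1 hζc hζ0
    have e : ∫ x, P x = (∫ x, f (u x) * ζ x) + (∫ x, D x)
        - ∫ x, inner ℝ (pFlux p (gradient u x)) (gradient ζ x) := by
      rw [← integral_add hi1 hi2]
      exact integral_sub (hi1.add hi2) hi3
    rw [e, hηint]
    linarith
  have hPz : ∀ x, P x = 0 := fun x => by
    by_contra hx
    exact absurd (hPc.integral_pos_of_hasCompactSupport_nonneg_nonzero hPs hP0 hx) hPint.not_gt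
  have hgz : ∀ x, fderiv ℝ ζ x = 0 := fun x => by
    have : gradient ζ x = 0 := by
      by_cases hx : x ∈ K
      · rw [hgradU x (hKU hx)]
        by_cases hg : gradient z x = gradient u x
        · simp [hg]
        · have h1 := hQP x (hKU hx)
          rw [hPz x] at h1
          have h2 := inner_pFlux_sub_pos hp hg
          have h3 : 2 * max (z x - u x) 0 ≤ 0 := by
            by_contra! h
            exact absurd (mul_pos h h2) h1.not_gt
          rw [le_antisymm h3 (by positivity), zero_smul]
      · exact hgradK x hx
    simpa [gradient] using this
  obtain ⟨y, hy⟩ : ∃ y, y ∉ K := by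
    have : Nonempty (Fin N) := ⟨0⟩
    have : NoncompactSpace (EuclideanSpace ℝ (Fin N)) := NormedSpace.noncompactSpace ℝ _
    exact (Set.ne_univ_iff_exists_notMem K).1 hK.ne_univ
  intro x hx
  have hζx : ζ x = 0 := by
    rw [is_const_of_fderiv_eq_zero (hζ1.differentiable one_ne_zero) hgz x y, hζK y hy]
  simp only [hζ, hx, if_true] at hζx
  have := pow_eq_zero_iff (two_ne_zero) |>.1 hζx
  linarith [le_max_left (z x - u x) 0]

/-! ### The blow-up profile -/

section

open Set

/-- The profile solving `(w' ^ (p - 1))' = (1 - 1 / p) g(w)`, `w 0 = α`, that blows up at a finite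
time `T`; here `b = w' ^ (p - 1)`. -/
theorem exists_blowup_profile {p : ℝ} (hp : 1 < p) {g : ℝ → ℝ} (hg : Continuous g)
    (hpos : ∀ t, 0 < t → 0 < g t) (hmono : MonotoneOn g (Ioi 0)) {α : ℝ} (hα : 0 < α)
    (hint : IntegrableOn (fun s => (∫ t in (0 : ℝ)..s, g t) ^ (-(1 / p))) (Ioi α)) :
    ∃ (T : ℝ) (w b : ℝ → ℝ), 0 < T ∧ w 0 = α ∧
      (∀ τ ∈ Ico 0 T, α ≤ w τ ∧ 0 < b τ ∧ ContDiffAt ℝ 1 w τ ∧ ContDiffAt ℝ 1 b τ ∧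
        HasDerivAt w (b τ ^ (1 / (p - 1))) τ ∧ HasDerivAt b ((1 - 1 / p) * g (w τ)) τ ∧
        b τ ≤ b 0 + τ * ((1 - 1 / p) * g (w τ))) ∧
      ∀ M, ∃ T' ∈ Ico 0 T, ∀ τ ∈ Ico T' T, M ≤ w τ := by
  have hp0 : 0 < p := by linarith
  have hp1 : 0 < p - 1 := by linarith
  -- The ODE is integrated through the first integral `w' ^ p = G(w)`: `w` inverts `H s = ∫ G ^ (-1
  -- / p)` from `α`, and `b = G(w) ^ (1 - 1 / p)`. Then `T = H(∞)`, finite by `hint`.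
  set G : ℝ → ℝ := fun s => ∫ t in (0 : ℝ)..s, g t with hG
  have hGd : ∀ s, HasDerivAt G (g s) s := fun s => hg.integral_hasStrictDerivAt 0 s |>.hasDerivAt
  have hGC : ContDiff ℝ 1 G := by
    rw [contDiff_one_iff_deriv]
    exact ⟨fun s => (hGd s).differentiableAt, by simpa only [funext fun s => (hGd s).deriv] using hg⟩
  have hGpos : ∀ s, 0 < s → 0 < G s := fun s hs =>
    intervalIntegral.intervalIntegral_pos_of_pos_on (hg.intervalIntegrable 0 s)
      (fun t ht => hpos t ht.1) hs
  set k : ℝ → ℝ := fun s => G s ^ (-(1 / p)) with hk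
  have hkpos : ∀ s, 0 < s → 0 < k s := fun s hs => Real.rpow_pos_of_pos (hGpos s hs) _
  have hkc : ∀ s, 0 < s → ContinuousAt k s := fun s hs =>
    hGC.continuous.continuousAt.rpow_const (Or.inl (hGpos s hs).ne')
  have hki : ∀ s t, 0 < s → 0 < t → IntervalIntegrable k volume s t := fun s t hs ht =>
    ContinuousOn.intervalIntegrable fun r hr =>
      (hkc r (lt_of_lt_of_le (lt_min hs ht) hr.1)).continuousWithinAt
  set H : ℝ → ℝ := fun s => ∫ t in α..s, k t with hH
  have hHd : ∀ s, 0 < s → HasStrictDerivAt H (k s) s := fun s hs =>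
    intervalIntegral.integral_hasStrictDerivAt_right (hki α s hα hs)
      (ContinuousOn.stronglyMeasurableAtFilter isOpen_Ioi
        (fun r (hr : 0 < r) => (hkc r hr).continuousWithinAt) s hs) (hkc s hs)
  have hHmono : StrictMonoOn H (Ioi 0) := by
    refine strictMonoOn_of_deriv_pos (convex_Ioi 0)
      (fun s hs => (hHd s hs).hasDerivAt.continuousAt.continuousWithinAt) fun s hs => ?_
    rw [interior_Ioi] at hs
    rw [(hHd s hs).hasDerivAt.deriv]
    exact hkpos s hs
  have hHα : H α = 0 := intervalIntegral.integral_same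
  set T := ∫ s in Ioi α, k s with hT
  have hHT : Filter.Tendsto H Filter.atTop (nhds T) :=
    intervalIntegral_tendsto_integral_Ioi α hint Filter.tendsto_id
  have hHlt : ∀ s, 0 < s → H s < T := fun s hs => by
    have h1 : H s < H (s + 1) := hHmono hs (show (0 : ℝ) < s + 1 by linarith) (by linarith)
    refine h1.trans_le (ge_of_tendsto hHT ?_)
    filter_upwards [Filter.eventually_ge_atTop (s + 1)] with r hr
    exact hHmono.monotoneOn (show (0 : ℝ) < s + 1 by linarith) (show (0 : ℝ) < r by linarith) hr
  have hsurj : ∀ τ ∈ Ico 0 T, ∃ s, α ≤ s ∧ H s = τ := fun τ hτ => by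
    obtain ⟨r, hr, hrα⟩ := ((hHT.eventually (eventually_gt_nhds hτ.2)).and
      (Filter.eventually_ge_atTop α)).exists
    have hc : ContinuousOn H (Icc α r) := fun s hs =>
      (hHd s (hα.trans_le hs.1)).hasDerivAt.continuousAt.continuousWithinAt
    obtain ⟨s, hs, hs'⟩ := intermediate_value_Icc hrα hc ⟨by rw [hHα]; exact hτ.1, hr.le⟩
    exact ⟨s, hs.1, hs'⟩
  -- Inverting on all of `Ioi 0`, not just beyond `α`, gives two-sided derivatives of `w` at time
  -- `0`.
  set w := Function.invFunOn H (Ioi 0) with hw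
  have hwH : ∀ s, 0 < s → w (H s) = s := fun s hs =>
    hHmono.injOn.leftInvOn_invFunOn hs
  have hwd : ∀ s, 0 < s → HasStrictDerivAt w (k s)⁻¹ (H s) := fun s hs =>
    (hHd s hs).to_local_left_inverse (hkpos s hs).ne' (by
      filter_upwards [eventually_gt_nhds hs] with r hr using hwH r hr)
  have hwC : ∀ s, 0 < s → ContDiffAt ℝ 1 w (H s) := fun s hs => by
    rw [contDiffAt_one_iff]
    refine ⟨fun τ => ContinuousLinearMap.toSpanSingleton ℝ (k (w τ))⁻¹, H '' Ioi 0, ?_, ?_, ?_⟩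
    · rw [← (hHd s hs).map_nhds_eq (hkpos s hs).ne']
      exact Filter.image_mem_map (Ioi_mem_nhds hs)
    · rintro _ ⟨r, hr, rfl⟩
      have h1 : ContinuousAt (fun τ => (k (w τ))⁻¹) (H r) := by
        refine ContinuousAt.inv₀ ?_ (by rw [hwH r hr]; exact (hkpos r hr).ne')
        exact ContinuousAt.comp (by rw [hwH r hr]; exact hkc r hr)
          (hwd r hr).hasDerivAt.continuousAt
      exact ((ContinuousLinearMap.toSpanSingletonCLE (𝕜 := ℝ) (E := ℝ)).continuous.continuousAt.comp
        h1).continuousWithinAt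
    · rintro _ ⟨r, hr, rfl⟩
      have := (hwd r hr).hasDerivAt.hasFDerivAt
      simpa only [hwH r hr] using this
  set b : ℝ → ℝ := fun τ => G (w τ) ^ (1 - 1 / p) with hb
  have hbC : ∀ s, 0 < s → ContDiffAt ℝ 1 b (H s) := fun s hs =>
    (hGC.contDiffAt.comp (H s) (hwC s hs)).rpow_const_of_ne (by
      simp only [Function.comp, hwH s hs]; exact (hGpos s hs).ne')
  have hbd : ∀ s, 0 < s → HasDerivAt b ((1 - 1 / p) * g s) (H s) := fun s hs => by
    have h1 : HasDerivAt (fun τ => G (w τ)) (g (w (H s)) * (k s)⁻¹) (H s) :=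
      (hGd (w (H s))).comp (H s) (hwd s hs).hasDerivAt
    have h2 := h1.rpow_const (p := 1 - 1 / p) (Or.inl (by rw [hwH s hs]; exact (hGpos s hs).ne'))
    refine h2.congr_deriv ?_
    rw [hwH s hs, hk, ← Real.rpow_neg (hGpos s hs).le, show 1 - 1 / p - 1 = -(1 / p) by ring,
      neg_neg]
    have : G s ^ (1 / p) * G s ^ (-(1 / p)) = 1 := by
      rw [← Real.rpow_add (hGpos s hs)]; simp
    linear_combination (1 - 1 / p) * g s * this
  have hq : 0 < 1 - 1 / p := by
    rw [sub_pos, div_lt_one hp0]; exact hp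
  refine ⟨T, w, b, by simpa [hHα] using hHlt α hα, by simpa [hHα] using hwH α hα, ?_, ?_⟩
  · intro τ hτ
    obtain ⟨s, hαs, rfl⟩ := hsurj τ hτ
    have hs : 0 < s := hα.trans_le hαs
    refine ⟨by rwa [hwH s hs], Real.rpow_pos_of_pos (by rw [hwH s hs]; exact hGpos s hs) _,
      hwC s hs, hbC s hs, ?_, by rw [hwH s hs]; exact hbd s hs, ?_⟩
    · refine (hwd s hs).hasDerivAt.congr_deriv ?_
      rw [hb, hk]
      simp only [hwH s hs]
      rw [← Real.rpow_neg (hGpos s hs).le, ← Real.rpow_mul (hGpos s hs).le]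
      congr 1
      field_simp
    · rw [hwH s hs]
      -- Up to time `H s` the profile stays at most `s`, so monotonicity of `g` bounds `b'` by its
      -- final value; the mean value inequality gives the bound on `b`.
      have hD : ∀ τ ∈ Icc 0 (H s), ∃ r, α ≤ r ∧ r ≤ s ∧ H r = τ := fun τ' h' => by
        obtain ⟨r, hr, hr'⟩ := hsurj τ' ⟨h'.1, h'.2.trans_lt hτ.2⟩
        exact ⟨r, hr, (hHmono.le_iff_le (hα.trans_le hr) hs).1 (hr' ▸ h'.2), hr'⟩
      have hder : ∀ τ ∈ Icc 0 (H s), DifferentiableAt ℝ b τ ∧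
          deriv b τ ≤ (1 - 1 / p) * g s := fun τ' h' => by
        obtain ⟨r, hr, hrs, rfl⟩ := hD τ' h'
        have hr0 := hα.trans_le hr
        exact ⟨(hbd r hr0).differentiableAt, by
          rw [(hbd r hr0).deriv]
          exact mul_le_mul_of_nonneg_left (hmono hr0 hs hrs) hq.le⟩
      have := (convex_Icc 0 (H s)).image_sub_le_mul_sub_of_deriv_le
        (fun t ht => (hder t ht).1.continuousAt.continuousWithinAt)
        (fun t ht => (hder t (interior_subset ht)).1.differentiableWithinAt)
        (fun t ht => (hder t (interior_subset ht)).2) 0 ⟨le_rfl, hτ.1⟩ (H s) ⟨hτ.1, le_rfl⟩ hτ.1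
      linarith
  · intro M
    have hM : 0 < max M α := lt_max_of_lt_right hα
    refine ⟨H (max M α), ⟨?_, hHlt _ hM⟩, fun τ hτ => ?_⟩
    · rw [← hHα]; exact hHmono.monotoneOn hα hM (le_max_right _ _)
    · have h0 : 0 ≤ H (max M α) := by
        rw [← hHα]; exact hHmono.monotoneOn hα hM (le_max_right _ _)
      obtain ⟨s, hαs, rfl⟩ := hsurj τ ⟨h0.trans hτ.1, hτ.2⟩
      have hs : 0 < s := hα.trans_le hαs
      rw [hwH s hs]
      exact (le_max_left M α).trans ((hHmono.le_iff_le hM hs).1 hτ.1)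

end

/-! ### Fluxes of radial functions and the reflected integral condition -/

theorem HasFDerivAt.gradient_of_innerSL {N : ℕ} {h : EuclideanSpace ℝ (Fin N) → ℝ}
    {x v : EuclideanSpace ℝ (Fin N)} {c : ℝ} (hh : HasFDerivAt h (c • innerSL ℝ v) x) :
    gradient h x = c • v := by
  refine HasGradientAt.gradient (hasGradientAt_iff_hasFDerivAt.2 (hh.congr_fderiv ?_))
  ext y
  simp

theorem pFlux_neg_mul_norm_rpow_smul {N : ℕ} {p s : ℝ} (hs : 0 ≤ s) (hp : 1 < p) (r : ℝ)
    (y : EuclideanSpace ℝ (Fin N)) :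
    pFlux p (-(s * ‖y‖ ^ r) • y) = -(s ^ (p - 1) * ‖y‖ ^ ((r + 1) * (p - 1) - 1)) • y := by
  rcases eq_or_ne y 0 with rfl | h
  · simp [pFlux]
  · have hy := norm_pos_iff.2 h
    have e : ‖-(s * ‖y‖ ^ r) • y‖ = s * ‖y‖ ^ (r + 1) := by
      rw [norm_smul, norm_neg, Real.norm_of_nonneg (by positivity), Real.rpow_add_one hy.ne']
      ring
    rw [pFlux, e, smul_smul, Real.mul_rpow hs (by positivity), ← Real.rpow_mul hy.le,
      ← rpow_sub_two_mul_self hp hs]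
    congr 1
    rw [show (r + 1) * (p - 1) - 1 = (r + 1) * (p - 2) + r by ring, Real.rpow_add hy]
    ring

/-- Starting the primitive at `0` instead of `1` enlarges it, hence lowers its negative power; on
`(α, 1]` the integrand is continuous up to the endpoints. -/
theorem integrableOn_reflected_primitive_rpow {p : ℝ} (hp : 1 < p) {f : ℝ → ℝ} (hf : Continuous f)
    (hf_pos : ∀ t < 0, 0 < f t)
    (hf_int : IntegrableOn (fun t : ℝ => (∫ s in t..(-1 : ℝ), f s) ^ (-(1 / p))) (Set.Iio (-1)))
    {α : ℝ} (hα : 0 < α) (hα1 : α ≤ 1) :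
    IntegrableOn (fun s => (∫ t in (0 : ℝ)..s, f (-t)) ^ (-(1 / p))) (Set.Ioi α) := by
  have hg : Continuous fun t => f (-t) := hf.comp continuous_neg
  have hpos : ∀ s r, 0 ≤ s → s < r → 0 < ∫ t in s..r, f (-t) := fun s r hs hr =>
    intervalIntegral.intervalIntegral_pos_of_pos_on (hg.intervalIntegrable s r)
      (fun t ht => hf_pos _ (neg_neg_of_pos (hs.trans_lt ht.1))) hr
  have hc : ContinuousOn (fun s => (∫ t in (0 : ℝ)..s, f (-t)) ^ (-(1 / p))) (Set.Ici α) :=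
    fun s hs => ((intervalIntegral.continuous_primitive (fun a b => hg.intervalIntegrable a b)
      0).continuousAt.rpow_const (Or.inl (hpos 0 s le_rfl (hα.trans_le hs)).ne')).continuousWithinAt
  rw [← Set.Ioc_union_Ioi_eq_Ioi hα1]
  refine IntegrableOn.union ?_ ?_
  · exact ((hc.mono Set.Icc_subset_Ici_self).integrableOn_Icc).mono_set Set.Ioc_subset_Icc_self
  · have h1 : IntegrableOn (fun s : ℝ => (∫ t in (-s)..(-1 : ℝ), f t) ^ (-(1 / p))) (Set.Ioi 1) :=
      hf_int.comp_neg_Ioi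
    refine Integrable.mono' h1 ((hc.mono fun s (hs : 1 < s) =>
      hα1.trans hs.le).aestronglyMeasurable measurableSet_Ioi) ?_
    filter_upwards [ae_restrict_mem measurableSet_Ioi] with s hs
    have hs1 : (1 : ℝ) < s := hs
    rw [← intervalIntegral.integral_comp_neg (fun t => f t),
      Real.norm_of_nonneg (Real.rpow_nonneg (hpos 0 s le_rfl (by linarith)).le _)]
    refine Real.rpow_le_rpow_of_nonpos (hpos 1 s zero_le_one hs1) ?_
      (neg_nonpos.2 (by positivity))
    rw [← intervalIntegral.integral_add_adjacent_intervals (hg.intervalIntegrable 0 1)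
      (hg.intervalIntegrable 1 s)]
    linarith [hpos 0 1 le_rfl one_pos]

/-! ### Nonnegativity -/

theorem IsSolutionPLaplaceGe.nonneg {N : ℕ} [NeZero N] {p : ℝ} (hp : 1 < p)
    {f : ℝ → ℝ} (hf : Continuous f) (hf_pos : ∀ t < 0, 0 < f t)
    (hf_anti : AntitoneOn f (Set.Iio 0))
    (hf_int : IntegrableOn (fun t : ℝ => (∫ s in t..(-1 : ℝ), f s) ^ (-(1 / p))) (Set.Iio (-1)))
    {u : EuclideanSpace ℝ (Fin N) → ℝ} (hu : IsSolutionPLaplaceGe p f u)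
    (x₀ : EuclideanSpace ℝ (Fin N)) : 0 ≤ u x₀ := by
  by_contra! hx₀
  have hp0 : 0 < p := by linarith
  have hp1 : 0 < p - 1 := by linarith
  set α := min (-u x₀ / 2) 1 with hαdef
  have hα : 0 < α := lt_min (by linarith) one_pos
  obtain ⟨T, w, b, hT, hw0, hprof, hblow⟩ := exists_blowup_profile hp (hf.comp continuous_neg)
    (fun t ht => hf_pos (-t) (neg_neg_of_pos ht))
    (fun s (hs : 0 < s) t (ht : 0 < t) hst => hf_anti (neg_neg_of_pos ht : -t < 0)
      (neg_neg_of_pos hs : -s < 0) (neg_le_neg hst)) hα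
    (integrableOn_reflected_primitive_rpow hp hf hf_pos hf_int hα (min_le_right _ _))
  simp only [Function.comp_apply] at hprof
  have hfα : 0 < f (-α) := hf_pos _ (neg_neg_of_pos hα)
  have hb0 : 0 < b 0 := (hprof 0 ⟨le_rfl, hT⟩).2.1
  -- For this `q` the powers of `‖x - x₀‖` in the flux cancel, leaving `-(κ * b (τ x)) • (x - x₀)`;
  -- since `q > 1`, the barrier is `C¹` at the centre too.
  set q := p / (p - 1) with hq
  have hq1 : 1 < q := by rw [hq, one_lt_div hp1]; linarith
  have hq0 : 0 < q := by linarith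
  have hqp : q * (1 - 1 / p) = 1 := by rw [hq]; field_simp
  have hr : 0 ≤ 1 - 1 / p := by
    by_contra! h
    nlinarith
  -- `C` is such that `N b + τ F ≤ C F` with `F = f (-w)`, using `F ≥ f (-α)`, `τ < T` and the bound
  -- on `b`; `l` is then fixed by `(l q) ^ (p - 1) * C = 1`.
  set C := N * b 0 / f (-α) + (N * (1 - 1 / p) + 1) * T with hC
  have hC0 : 0 < C := by positivity
  set l := C ^ (-(1 / (p - 1))) / q with hl
  have hl0 : 0 < l := by positivity
  have hlC : (l * q) ^ (p - 1) * C = 1 := by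
    rw [hl, div_mul_cancel₀ _ hq0.ne', ← Real.rpow_mul hC0.le,
      show -(1 / (p - 1)) * (p - 1) = -1 by field_simp, Real.rpow_neg_one, inv_mul_cancel₀ hC0.ne']
  set κ := (l * q) ^ (p - 1) with hκ
  have hκ0 : 0 < κ := by positivity
  set τ : EuclideanSpace ℝ (Fin N) → ℝ := fun x => l * ‖x - x₀‖ ^ q with hτ
  have hτ0 : ∀ x, 0 ≤ τ x := fun x => by positivity
  have hτ1 : ContDiff ℝ 1 τ :=
    contDiff_const.mul (ContDiff.norm_rpow (contDiff_id.sub contDiff_const) hq1)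
  have hτd : ∀ x, HasFDerivAt τ ((l * q * ‖x - x₀‖ ^ (q - 2)) • innerSL ℝ (x - x₀)) x := fun x => by
    have h1 := (hasFDerivAt_norm_rpow (x - x₀) hq1).comp x ((hasFDerivAt_id x).sub_const x₀)
    refine (h1.const_mul l).congr_fderiv ?_
    ext y
    simp
    ring
  have hτy : ∀ x, l * q * ‖x - x₀‖ ^ (q - 2) * ‖x - x₀‖ ^ 2 = q * τ x := fun x => by
    have h1 := rpow_sub_two_mul_self hq1 (norm_nonneg (x - x₀))
    have h2 := rpow_sub_two_mul_self (p := q + 1) (by linarith) (norm_nonneg (x - x₀))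
    rw [show q + 1 - 2 = q - 1 by ring, show q + 1 - 1 = q by ring, ← h1] at h2
    simp only [hτ]
    rw [← h2]; ring
  have hbdd : ∀ S, Bornology.IsBounded {x | τ x ≤ S} := fun S => by
    refine (Metric.isBounded_closedBall (x := x₀) (r := (S / l) ^ q⁻¹)).subset fun x hx => ?_
    have hx' : l * ‖x - x₀‖ ^ q ≤ S := hx
    have h1 : ‖x - x₀‖ ^ q ≤ S / l := by rw [le_div_iff₀ hl0]; linarith
    rw [Metric.mem_closedBall, dist_eq_norm]
    exact (Real.le_rpow_inv_iff_of_pos (norm_nonneg _) (le_trans (by positivity) h1) hq0).2 h1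
  have hcomp : ∀ S, IsCompact {x | τ x ≤ S} := fun S =>
    Metric.isCompact_of_isClosed_isBounded (isClosed_le hτ1.continuous continuous_const) (hbdd S)
  -- `|u| ≤ M` on the closed ball, while `w ≥ M` after `T'`; this yields `z ≤ u` near the boundary.
  obtain ⟨M, hM⟩ := (hcomp T).exists_bound_of_continuousOn hu.1.continuous.continuousOn
  obtain ⟨T', hT', hMT⟩ := hblow M
  have hmem : ∀ x, τ x < T → τ x ∈ Set.Ico 0 T := fun x hx => ⟨hτ0 x, hx⟩
  have key := hu.le_of_subsolution hp hf (U := {x | τ x < T}) (K := {x | τ x ≤ T'})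
    (z := fun x => -w (τ x)) (a := fun x => -(κ * b (τ x))) (x₀ := x₀)
    (isOpen_lt hτ1.continuous continuous_const) (hcomp T')
    (fun x (hx : τ x ≤ T') => hx.trans_lt hT'.2)
    (fun x hx => ((hprof _ (hmem x hx)).2.2.1.comp x hτ1.contDiffAt).neg)
    (fun x hx => (contDiffAt_const.mul ((hprof _ (hmem x hx)).2.2.2.1.comp x hτ1.contDiffAt)).neg)
    ?_ ?_ ?_ x₀ ?_
  · have hτx : τ x₀ = 0 := by simp [hτ, Real.zero_rpow hq0.ne']
    simp only [hτx, hw0] at key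
    linarith [min_le_left (-u x₀ / 2) 1]
  · intro x hx
    obtain ⟨-, hbx, -, -, hwd, -, -⟩ := hprof _ (hmem x hx)
    have hd : HasFDerivAt (fun x => -w (τ x))
        (-(b (τ x) ^ (1 / (p - 1)) * (l * q) * ‖x - x₀‖ ^ (q - 2)) • innerSL ℝ (x - x₀)) x := by
      refine (hwd.comp_hasFDerivAt x (hτd x)).neg.congr_fderiv ?_
      rw [smul_smul, ← neg_smul]
      congr 2; ring
    rw [hd.gradient_of_innerSL, pFlux_neg_mul_norm_rpow_smul (by positivity) hp,
      Real.mul_rpow (by positivity) (by positivity), ← Real.rpow_mul hbx.le,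
      show (q - 2 + 1) * (p - 1) - 1 = 0 by rw [hq]; field_simp; ring,
      show 1 / (p - 1) * (p - 1) = 1 by field_simp, Real.rpow_zero, Real.rpow_one]
    congr 2; ring
  · intro x hx hux
    obtain ⟨hwα, hbx, -, -, -, hbd, hble⟩ := hprof _ (hmem x hx)
    have hd : HasFDerivAt (fun x => -(κ * b (τ x))) _ x :=
      ((hbd.comp_hasFDerivAt x (hτd x)).const_mul κ).neg
    have hfd : fderiv ℝ (fun x => -(κ * b (τ x))) x (x - x₀) = -(κ * (τ x * f (-w (τ x)))) := by
      rw [hd.fderiv]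
      simp only [neg_apply, smul_apply, smul_eq_mul,
        innerSL_apply_apply, real_inner_self_eq_norm_sq]
      rw [hτy]
      linear_combination -κ * τ x * f (-w (τ x)) * hqp
    rw [hfd]
    have hw1 : 0 < w (τ x) := hα.trans_le hwα
    have hfu : f (-w (τ x)) ≤ f (u x) :=
      hf_anti (show u x < 0 by linarith) (show -w (τ x) < 0 by linarith) hux.le
    have hfw : f (-α) ≤ f (-w (τ x)) :=
      hf_anti (show -w (τ x) < 0 by linarith) (show -α < 0 by linarith) (by linarith)
    set F := f (-w (τ x))
    have hF0 : 0 < F := hfα.trans_le hfw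
    have h1 : b 0 ≤ b 0 / f (-α) * F := by
      rw [div_mul_eq_mul_div, le_div_iff₀ hfα]
      exact mul_le_mul_of_nonneg_left hfw hb0.le
    have h2 : τ x * F ≤ T * F := mul_le_mul_of_nonneg_right (le_of_lt hx) hF0.le
    have h3 : (N : ℝ) * b (τ x) ≤ N * (b 0 / f (-α) * F + (1 - 1 / p) * (T * F)) := by
      refine mul_le_mul_of_nonneg_left ?_ (Nat.cast_nonneg N)
      have := mul_le_mul_of_nonneg_left h2 hr
      linarith
    have h4 : N * b (τ x) + τ x * F ≤ C * F := by
      calc _ ≤ N * (b 0 / f (-α) * F + (1 - 1 / p) * (T * F)) + T * F := add_le_add h3 h2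
        _ = C * F := by rw [hC]; ring
    have h5 := mul_le_mul_of_nonneg_left h4 hκ0.le
    have h6 : κ * (C * F) = F := by rw [← mul_assoc, hlC, one_mul]
    linarith
  · intro x hx hxK
    have hx' : T' < τ x := not_le.1 hxK
    have h1 := hMT (τ x) ⟨hx'.le, hx⟩
    have h2 := hM x (show τ x ≤ T from le_of_lt hx)
    linarith [neg_abs_le (u x), Real.norm_eq_abs (u x)]
  · simpa [hτ, Real.zero_rpow hq0.ne'] using hT

/-! ### The strong maximum principle -/

theorem hasFDerivAt_norm_sub_rpow {N : ℕ} {x x₀ : EuclideanSpace ℝ (Fin N)} (h : x - x₀ ≠ 0)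
    (r : ℝ) : HasFDerivAt (fun x => ‖x - x₀‖ ^ r)
      ((r * ‖x - x₀‖ ^ (r - 2)) • innerSL ℝ (x - x₀)) x := by
  have hy := norm_pos_iff.2 h
  have h1 : HasFDerivAt (fun x => ‖x - x₀‖ ^ 2) (2 • innerSL ℝ (x - x₀)) x :=
    HasFDerivAt.comp (f := fun x => x - x₀) x (hasStrictFDerivAt_norm_sq (x - x₀)).hasFDerivAt
      ((hasFDerivAt_id x).sub_const x₀)
  have h2 := h1.rpow_const (p := r / 2) (Or.inl (by positivity))
  have e : ∀ t : ℝ, 0 ≤ t → ∀ s : ℝ, (t ^ 2) ^ (s / 2) = t ^ s := fun t ht s => by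
    rw [← Real.rpow_natCast_mul ht]; congr 1; push_cast; ring
  simp only [e _ (norm_nonneg _)] at h2
  refine h2.congr_fderiv ?_
  rw [show r / 2 - 1 = (r - 2) / 2 by ring, e _ (norm_nonneg _)]
  ext y
  simp
  ring

theorem contDiffAt_norm_sub_rpow {N : ℕ} {x x₀ : EuclideanSpace ℝ (Fin N)} (h : x - x₀ ≠ 0)
    (r : ℝ) : ContDiffAt ℝ 1 (fun x => ‖x - x₀‖ ^ r) x :=
  ((contDiffAt_id.sub contDiffAt_const).norm ℝ h).rpow_const_of_ne (norm_ne_zero_iff.2 h)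

/-- The strong maximum principle, by Hopf's boundary point argument. -/
theorem IsSolutionPLaplaceGe.eq_zero_or_pos {N : ℕ} [NeZero N] {p : ℝ} (hp : 1 < p)
    {f : ℝ → ℝ} (hf : Continuous f) (hf0 : ∀ t, 0 ≤ t → 0 ≤ f t)
    {u : EuclideanSpace ℝ (Fin N) → ℝ} (hu : IsSolutionPLaplaceGe p f u) (hu0 : ∀ x, 0 ≤ u x) :
    (∀ x, u x = 0) ∨ ∀ x, 0 < u x := by
  by_contra! hcon
  obtain ⟨⟨x₀, hx₀⟩, x₁, hx₁⟩ := hcon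
  have huc := hu.1.continuous
  have hp1 : 0 < p - 1 := by linarith
  have hZ : IsClosed {x | u x = 0} := isClosed_eq huc continuous_const
  obtain ⟨y, hy, hyd⟩ := hZ.exists_infDist_eq_dist ⟨x₁, le_antisymm hx₁ (hu0 x₁)⟩ x₀
  have hy0 : u y = 0 := hy
  set d := ‖y - x₀‖ with hd
  have hd0 : 0 < d := norm_pos_iff.2 (sub_ne_zero.2 fun h => hx₀ (h ▸ hy0))
  have hball : ∀ x, ‖x - x₀‖ < d → 0 < u x := fun x hx => by
    refine (hu0 x).lt_of_ne fun h => ?_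
    have := Metric.infDist_le_dist_of_mem (x := x₀) (show x ∈ {x | u x = 0} from h.symm)
    rw [hyd, dist_comm, dist_eq_norm, dist_comm, dist_eq_norm] at this
    linarith
  obtain ⟨m, hm0, hm⟩ : ∃ m, 0 < m ∧ ∀ x, ‖x - x₀‖ ≤ d / 2 → m ≤ u x := by
    obtain ⟨xm, hxm, hmin⟩ := (isCompact_closedBall x₀ (d / 2)).exists_isMinOn
      ⟨x₀, Metric.mem_closedBall_self (by positivity)⟩ huc.continuousOn
    rw [Metric.mem_closedBall, dist_eq_norm] at hxm
    exact ⟨u xm, hball xm (by linarith), fun x hx => hmin (by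
      rwa [Metric.mem_closedBall, dist_eq_norm])⟩
  have hN : (0 : ℝ) < N := Nat.cast_pos.2 (NeZero.pos N)
  -- The flux coefficient is then a negative multiple of `‖x - x₀‖ ^ m'` with `m' = -N - p`, so `N +
  -- m' < 0` and the barrier is a subsolution of the equation with right side `0`.
  set β := N / (p - 1) with hβ
  have hβ0 : 0 < β := by positivity
  set ε := m / (d / 4) ^ (-β) with hε
  have hε0 : 0 < ε := by positivity
  set κ := (ε * β) ^ (p - 1) with hκ
  have hκ0 : 0 < κ := by positivity
  have hne : ∀ x, d / 4 < ‖x - x₀‖ → x - x₀ ≠ 0 := fun x hx =>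
    norm_pos_iff.1 (lt_trans (by positivity) hx)
  have hzd : ∀ x, d / 4 < ‖x - x₀‖ → HasFDerivAt (fun x => ε * (‖x - x₀‖ ^ (-β) - d ^ (-β)))
      (-(ε * β * ‖x - x₀‖ ^ (-β - 2)) • innerSL ℝ (x - x₀)) x := fun x hx => by
    refine (((hasFDerivAt_norm_sub_rpow (hne x hx) (-β)).sub_const _).const_mul ε).congr_fderiv ?_
    rw [smul_smul]
    congr 1; ring
  have hnc : Continuous fun x : EuclideanSpace ℝ (Fin N) => ‖x - x₀‖ := by fun_prop
  -- Beyond radius `d` the barrier is nonpositive, so the comparison holds on both sides of the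
  -- sphere and `y` becomes an interior touching point; no one-sided normal derivative is needed.
  have key := hu.le_of_subsolution hp hf (U := {x | d / 4 < ‖x - x₀‖})
    (K := {x | d / 2 ≤ ‖x - x₀‖} ∩ Metric.closedBall x₀ d)
    (z := fun x => ε * (‖x - x₀‖ ^ (-β) - d ^ (-β)))
    (a := fun x => -(κ * ‖x - x₀‖ ^ ((-β - 2 + 1) * (p - 1) - 1))) (x₀ := x₀)
    (isOpen_lt continuous_const hnc)
    ((isCompact_closedBall x₀ d).inter_left (isClosed_le continuous_const hnc))
    (fun x hx => show d / 4 < ‖x - x₀‖ by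
      have : d / 2 ≤ ‖x - x₀‖ := hx.1
      linarith)
    (fun x hx => contDiffAt_const.mul
      ((contDiffAt_norm_sub_rpow (hne x hx) _).sub contDiffAt_const))
    (fun x hx => (contDiffAt_const.mul (contDiffAt_norm_sub_rpow (hne x hx) _)).neg)
    (fun x hx => by
      rw [(hzd x hx).gradient_of_innerSL, pFlux_neg_mul_norm_rpow_smul (by positivity) hp])
    ?_ ?_
  · have hyU : d / 4 < ‖y - x₀‖ := by rw [← hd]; linarith
    have hsub := (hu.1.differentiable one_ne_zero y).hasFDerivAt.sub (hzd y hyU)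
    have hzy : ε * (‖y - x₀‖ ^ (-β) - d ^ (-β)) = 0 := by rw [← hd]; ring
    have hmin : IsLocalMin (fun x => u x - ε * (‖x - x₀‖ ^ (-β) - d ^ (-β))) y := by
      filter_upwards [(isOpen_lt continuous_const hnc).mem_nhds hyU] with x hx
      rw [hzy, hy0]
      linarith [key x hx]
    have humin : IsLocalMin u y := Filter.Eventually.of_forall fun x => by
      rw [hy0]; exact hu0 x
    have h1 := hmin.hasFDerivAt_eq_zero hsub
    rw [humin.fderiv_eq_zero] at h1
    have h2 := congrArg (fun L : EuclideanSpace ℝ (Fin N) →L[ℝ] ℝ => L (y - x₀)) h1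
    simp only [zero_sub, neg_smul, neg_neg, smul_apply, smul_eq_mul,
      innerSL_apply_apply, real_inner_self_eq_norm_sq, zero_apply, ← hd] at h2
    have h3 : 0 < ε * β * d ^ (-β - 2) * d ^ 2 := by positivity
    linarith
  · intro x hx _
    have hy' := norm_pos_iff.2 (hne x hx)
    set m' := (-β - 2 + 1) * (p - 1) - 1 with hm'
    have hmN : m' ≤ -N := by
      have : β * (p - 1) = N := by rw [hβ]; field_simp
      rw [hm']; nlinarith
    have hd : HasFDerivAt (fun x => -(κ * ‖x - x₀‖ ^ m')) _ x :=
      ((hasFDerivAt_norm_sub_rpow (hne x hx) m').const_mul κ).neg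
    rw [hd.fderiv]
    simp only [neg_apply, smul_apply, smul_eq_mul,
      innerSL_apply_apply, real_inner_self_eq_norm_sq]
    have e : ‖x - x₀‖ ^ (m' - 2) * ‖x - x₀‖ ^ 2 = ‖x - x₀‖ ^ m' := by
      rw [← Real.rpow_natCast, ← Real.rpow_add hy']; congr 1; push_cast; ring
    have h1 : 0 < κ * ‖x - x₀‖ ^ m' := by positivity
    have h2 : -(N * -(κ * ‖x - x₀‖ ^ m') + -(κ * (m' * ‖x - x₀‖ ^ (m' - 2) * ‖x - x₀‖ ^ 2))) =
        (N + m') * (κ * ‖x - x₀‖ ^ m') := by rw [← e]; ring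
    rw [h2]
    exact (mul_nonpos_of_nonpos_of_nonneg (by linarith) h1.le).trans (hf0 _ (hu0 x))
  · intro x hx hxK
    have hx' : d / 4 < ‖x - x₀‖ := hx
    have hy' := norm_pos_iff.2 (hne x hx)
    rcases lt_or_ge d ‖x - x₀‖ with h | h
    · have := Real.rpow_le_rpow_of_nonpos hd0 h.le (neg_nonpos.2 hβ0.le)
      exact (mul_nonpos_of_nonneg_of_nonpos hε0.le (by linarith)).trans (hu0 x)
    · have h1 : ‖x - x₀‖ < d / 2 := by
        by_contra! h2
        exact hxK ⟨h2, by rwa [Metric.mem_closedBall, dist_eq_norm]⟩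
      have h2 : ‖x - x₀‖ ^ (-β) ≤ (d / 4) ^ (-β) :=
        Real.rpow_le_rpow_of_nonpos (by positivity) hx'.le (neg_nonpos.2 hβ0.le)
      have h3 : 0 < d ^ (-β) := by positivity
      calc ε * (‖x - x₀‖ ^ (-β) - d ^ (-β)) ≤ ε * (d / 4) ^ (-β) :=
            mul_le_mul_of_nonneg_left (by linarith) hε0.le
        _ = m := by rw [hε]; field_simp
        _ ≤ u x := hm x h1.le

theorem mainTheorem1 (N : ℕ) (hN : 1 < N) (p : ℝ) (hp : 1 < p)
    (f : ℝ → ℝ) (hf : Continuous f) (hf_pos : ∀ t < 0, 0 < f t)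
    (hf_anti : AntitoneOn f (Set.Iio 0))
    (hf_int : IntegrableOn (fun t : ℝ => (∫ s in t..(-1 : ℝ), f s) ^ (-(1 / p))) (Set.Iio (-1)))
    (u : EuclideanSpace ℝ (Fin N) → ℝ) (hu : IsSolutionPLaplaceGe p f u) :
    (∀ x, 0 ≤ u x) ∧
      ((∀ t, 0 ≤ t → 0 ≤ f t) → (∀ x, u x = 0) ∨ (∀ x, 0 < u x)) := by
  have : NeZero N := ⟨by omega⟩
  have h0 := hu.nonneg hp hf hf_pos hf_anti hf_int
  exact ⟨h0, fun hf0 => hu.eq_zero_or_pos hp hf hf0 h0⟩
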